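/- Let $\Omega$ be a locally compact Hausdorff space, and let $E$ and $F$ be two Hilbert $C_0(\Omega)$-modules, where $C_0(\Omega)$ is the $C^*$-algebra of continuous complex-valued functions on $\Omega$ vanishing at infinity. Suppose that $F$ is full, that is, the linear span of $\{\langle f,g\rangle : f,g\in F\}$ is dense in $C_0(\Omega)$. Let $\theta:E\to F$ be a surjective $\mathbb{C}$-linear map (not assumed to be bounded) that is local ($\theta(e)a=0$ whenever $e\in E$, $a\in C_0(\Omega)$ and $ea=0$) and orthogonality preserving ($\langle\theta(x),\theta(y)\rangle=0$ whenever $x,y\in E$ and $\langle x,y\rangle=0$). Then $\theta$ is a bounded $C_0(\Omega)$-module homomorphism. Moreover, there exist a bounded continuous function $\psi:\Omega\to\mathbb{R}$ with $\psi(\omega)>0$ for all $\omega\in\Omega$, and a unitary $U:E\to F$ (a bounded $C_0(\Omega)$-module homomorphism with an adjoint $U^*:F\to E$ such that $U^*U=1_E$ and $UU^*=1_F$), such that $\theta=\psi\cdot U$, that is, $\theta(e)(\omega)=\psi(\omega)\,U(e)(\omega)$ for all $e\in E$ and $\omega\in\Omega$. Here $f(\omega)$, for $f\in F$, denotes the class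 of $f$ in the fibre $F/\{g\in F:\langle g,g\rangle(\omega)=0\}$. -/

import Mathlib

open scoped ZeroAtInfty BoundedContinuousFunction

/-- The order of the C⋆-algebra `C₀(Ω, ℂ)`: `f ≤ g` iff `g ω - f ω` is a nonnegative real number
for every `ω`. -/
instance ZeroAtInftyContinuousMap.instPartialOrderComplex {Ω : Type*} [TopologicalSpace Ω] :
    PartialOrder C₀(Ω, ℂ) where
  le f g := ∀ ω, Complex.partialOrder.le (f ω) (g ω)
  le_refl f ω := Complex.partialOrder.le_refl (f ω)
  le_trans f g h hfg hgh ω := Complex.partialOrder.le_trans _ _ _ (hfg ω) (hgh ω)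
  le_antisymm f g hfg hgf := DFunLike.ext f g fun ω =>
    Complex.partialOrder.le_antisymm _ _ (hfg ω) (hgf ω)

/- A Hilbert `C₀(Ω)`-module is a Banach space `E` with Mathlib's `CStarModule C₀(Ω, ℂ) E`. Since
`C₀(Ω)` is commutative, its action is written on the left. The axioms of the action (additivity,
associativity, compatibility with `ℂ`) follow from those of the definite inner product. -/

namespace HilbertC0

/-- Fullness: the linear span of the inner products is dense in `C₀(Ω)`. -/
def IsFull (Ω E : Type*) [TopologicalSpace Ω] [NormedAddCommGroup E] [NormedSpace ℂ E]
    [SMul C₀(Ω, ℂ) E] [CStarModule C₀(Ω, ℂ) E] : Prop :=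
  Dense (Submodule.span ℂ {f : C₀(Ω, ℂ) | ∃ x y : E, inner C₀(Ω, ℂ) x y = f} : Set C₀(Ω, ℂ))

section Maps

variable (Ω : Type*) {E F : Type*} [TopologicalSpace Ω]
  [NormedAddCommGroup E] [NormedSpace ℂ E] [SMul C₀(Ω, ℂ) E]
  [NormedAddCommGroup F] [NormedSpace ℂ F] [SMul C₀(Ω, ℂ) F]

/-- A linear map is local if `θ(e)a = 0` whenever `ea = 0`. -/
def IsLocal (θ : E →ₗ[ℂ] F) : Prop :=
  ∀ (e : E) (a : C₀(Ω, ℂ)), a • e = 0 → a • θ e = 0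

variable (E F) in
/-- The set of bounded `C₀(Ω)`-module homomorphisms among all linear maps `E → F`. -/
def boundedModuleHoms : Set (E →ₗ[ℂ] F) :=
  {T | (∃ C : ℝ, ∀ x : E, ‖T x‖ ≤ C * ‖x‖) ∧ ∀ (a : C₀(Ω, ℂ)) (x : E), T (a • x) = a • T x}

variable [CStarModule C₀(Ω, ℂ) E] [CStarModule C₀(Ω, ℂ) F]

/-- `⟨θ x, θ y⟩ = 0` whenever `⟨x, y⟩ = 0`. -/
def PreservesOrthogonality (θ : E →ₗ[ℂ] F) : Prop :=
  ∀ x y : E, inner C₀(Ω, ℂ) x y = 0 → inner C₀(Ω, ℂ) (θ x) (θ y) = 0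

/-- A unitary between Hilbert modules: a bounded module homomorphism `U` with an adjoint `V` such
that `VU = 1` and `UV = 1`. -/
def IsUnitary (U : E →ₗ[ℂ] F) : Prop :=
  U ∈ boundedModuleHoms Ω E F ∧
    ∃ V ∈ boundedModuleHoms Ω F E,
      (∀ (x : E) (y : F), inner C₀(Ω, ℂ) (U x) y = inner C₀(Ω, ℂ) x (V y)) ∧
      V ∘ₗ U = LinearMap.id ∧ U ∘ₗ V = LinearMap.id

end Maps

section Fibres

variable {Ω : Type*} (E : Type*) [TopologicalSpace Ω] [NormedAddCommGroup E] [NormedSpace ℂ E]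
  [SMul C₀(Ω, ℂ) E] [CStarModule C₀(Ω, ℂ) E]

/-- The submodule of all `f` that vanish at `ω`, that is, with `⟨f, f⟩(ω) = 0`. -/
def vanishingAt (ω : Ω) : Submodule ℂ E where
  carrier := {f | inner C₀(Ω, ℂ) f f ω = 0}
  zero_mem' := by simp
  add_mem' := by
    intro f g hf hg
    simp only [Set.mem_ofPred_eq] at hf hg ⊢
    -- parallelogram law, and both terms on its left-hand side are nonnegative
    have h1 := (CStarModule.inner_self_nonneg (A := C₀(Ω, ℂ)) (x := f + g)) ω
    have h2 := (CStarModule.inner_self_nonneg (A := C₀(Ω, ℂ)) (x := f - g)) ω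
    have h3 : inner C₀(Ω, ℂ) (f + g) (f + g) ω + inner C₀(Ω, ℂ) (f - g) (f - g) ω = 0 := by
      simp only [CStarModule.inner_add_right, CStarModule.inner_add_left,
        CStarModule.inner_sub_right, CStarModule.inner_sub_left,
        ZeroAtInftyContinuousMap.add_apply, ZeroAtInftyContinuousMap.sub_apply]
      linear_combination 2 * hf + 2 * hg
    obtain ⟨h1r, h1i⟩ := h1
    obtain ⟨h2r, h2i⟩ := h2
    simp only [ZeroAtInftyContinuousMap.zero_apply, Complex.zero_re, Complex.zero_im] at *
    have h4 := congrArg Complex.re h3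
    simp only [Complex.add_re, Complex.zero_re] at h4
    exact Complex.ext (by simp only [Complex.zero_re]; linarith) (by simpa using h1i.symm)
  smul_mem' := by
    intro c f hf
    simp only [Set.mem_ofPred_eq] at hf ⊢
    simp [hf]

/-- The fibre at `ω` of the Hilbert bundle of `E`. -/
abbrev Fibre (ω : Ω) : Type _ := E ⧸ vanishingAt E ω

variable {E}

/-- The value `f(ω)` of `f`, viewed as a section of the Hilbert bundle of `E`. -/
def value (f : E) (ω : Ω) : Fibre E ω := (vanishingAt E ω).mkQ f

end Fibres

end HilbertC0

/-!
Let `θ` be local and `e(ω) = 0`. Multiplying `e` by a staircase function of `‖e(·)‖^(-1/2)` gives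
a section `x` of `E`, because `‖e(·)‖^(1/2)` vanishes with `e`. On the steps `x` is an integer
multiple `n e` with `n` close to `‖e(·)‖^(-1/2)`, and locality gives `θ x = n θ e` there. Since
`θ x` is a bounded section, two staircases whose steps overlap yield
`‖(θ e)(·)‖ ≤ M ‖e(·)‖^(1/2)` away from the zeros of `e`. Locality then forces `(θ e)(ω) = 0`,
so `θ` acts on the fibres.

A linear map between Hilbert spaces that preserves orthogonality is a multiple of an isometry.
Hence `‖(θ e)(ω)‖ = ψ(ω) ‖e(ω)‖` for a function `ψ`, which is positive and continuous because `θ`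
is onto and the fibres of `F` are nonzero. By the closed graph theorem `θ` and `θ⁻¹` are bounded;
as every vector of a fibre is the value of a section of the same norm, `ψ` and `ψ⁻¹` are bounded
as well, and `U = ψ⁻¹ θ` is the required unitary.
-/

open Filter Topology

namespace HilbertC0

/-- The composition `k ∘ f` of a function vanishing at infinity with a continuous function fixing
zero. -/
def postcomp {Ω β γ : Type*} [TopologicalSpace Ω] [TopologicalSpace β] [Zero β]
    [TopologicalSpace γ] [Zero γ] (k : C(β, γ)) (hk : k 0 = 0) (f : C₀(Ω, β)) : C₀(Ω, γ) where
  toContinuousMap := k.comp f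
  zero_at_infty' := by simpa [hk] using (k.continuous.tendsto 0).comp f.zero_at_infty'

section Fibre

variable {Ω E : Type*} [TopologicalSpace Ω] [NormedAddCommGroup E] [NormedSpace ℂ E]
  [SMul C₀(Ω, ℂ) E] [CStarModule C₀(Ω, ℂ) E]

lemma inner_self_apply (x : E) (ω : Ω) :
    inner C₀(Ω, ℂ) x x ω = (‖inner C₀(Ω, ℂ) x x ω‖ : ℂ) :=
  (Complex.norm_of_nonneg' (CStarModule.inner_self_nonneg (A := C₀(Ω, ℂ)) (x := x) ω)).symm

lemma star_inner_apply (x y : E) (ω : Ω) :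
    star (inner C₀(Ω, ℂ) x y ω) = inner C₀(Ω, ℂ) y x ω := by
  rw [← ZeroAtInftyContinuousMap.star_apply, CStarModule.star_inner]

lemma norm_sq_le_iff {x : E} {C : ℝ} (hC : 0 ≤ C) :
    ‖x‖ ^ 2 ≤ C ↔ ∀ ω : Ω, ‖inner C₀(Ω, ℂ) x x ω‖ ≤ C := by
  rw [CStarModule.norm_sq_eq C₀(Ω, ℂ), ← ZeroAtInftyContinuousMap.norm_toBCF_eq_norm]
  exact BoundedContinuousFunction.norm_le hC

variable (E) in
/-- The positive semidefinite inner product `(x, y) ↦ ⟨x, y⟩(ω)` on `E`. -/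
@[reducible] noncomputable def preInnerCore (ω : Ω) : PreInnerProductSpace.Core ℂ E where
  inner x y := inner C₀(Ω, ℂ) x y ω
  conj_inner_symm x y := star_inner_apply y x ω
  re_inner_nonneg x := (CStarModule.inner_self_nonneg (A := C₀(Ω, ℂ)) (x := x) ω).1
  add_left x y z := by simp
  smul_left x y c := by simp

lemma inner_apply_eq_zero_of_mem_vanishingAt {x : E} {ω : Ω} (hx : x ∈ vanishingAt E ω) (y : E) :
    inner C₀(Ω, ℂ) x y ω = 0 := by
  have h : ‖inner C₀(Ω, ℂ) x y ω‖ * ‖inner C₀(Ω, ℂ) y x ω‖ ≤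
      (inner C₀(Ω, ℂ) x x ω).re * (inner C₀(Ω, ℂ) y y ω).re :=
    @InnerProductSpace.Core.inner_mul_inner_self_le ℂ E _ _ _ (preInnerCore E ω) x y
  rw [show inner C₀(Ω, ℂ) x x ω = 0 from hx, Complex.zero_re, zero_mul, ← star_inner_apply x y,
    norm_star] at h
  exact norm_eq_zero.1 (mul_self_eq_zero.1 (h.antisymm (mul_self_nonneg _)))

lemma inner_apply_congr {x x' y y' : E} {ω : Ω} (hx : x - x' ∈ vanishingAt E ω)
    (hy : y - y' ∈ vanishingAt E ω) : inner C₀(Ω, ℂ) x y ω = inner C₀(Ω, ℂ) x' y' ω := by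
  have hx := inner_apply_eq_zero_of_mem_vanishingAt hx y
  have hy : inner C₀(Ω, ℂ) x' (y - y') ω = 0 := by
    rw [← star_inner_apply, inner_apply_eq_zero_of_mem_vanishingAt hy, star_zero]
  simp only [CStarModule.inner_sub_left, CStarModule.inner_sub_right,
    ZeroAtInftyContinuousMap.sub_apply] at hx hy
  linear_combination hx + hy

/-- The inner product `⟨x(ω), y(ω)⟩ = ⟨x, y⟩(ω)` of the fibre at `ω`. -/
noncomputable instance (ω : Ω) : Inner ℂ (Fibre E ω) where
  inner u v := Quotient.liftOn₂' u v (fun x y => inner C₀(Ω, ℂ) x y ω) fun _ _ _ _ hx hy =>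
    inner_apply_congr ((Submodule.quotientRel_def _).1 hx) ((Submodule.quotientRel_def _).1 hy)

lemma inner_value (x y : E) (ω : Ω) :
    inner ℂ (value x ω) (value y ω) = inner C₀(Ω, ℂ) x y ω :=
  rfl

lemma value_zero (ω : Ω) : value (0 : E) ω = 0 :=
  map_zero _

lemma value_add (x y : E) (ω : Ω) : value (x + y) ω = value x ω + value y ω :=
  map_add _ x y

lemma value_sub (x y : E) (ω : Ω) : value (x - y) ω = value x ω - value y ω :=
  map_sub _ x y

lemma value_smul (c : ℂ) (x : E) (ω : Ω) : value (c • x) ω = c • value x ω :=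
  map_smul _ c x

lemma value_surjective (ω : Ω) : Function.Surjective fun x : E => value x ω :=
  (vanishingAt E ω).mkQ_surjective

lemma value_eq_zero_iff {x : E} {ω : Ω} : value x ω = 0 ↔ inner C₀(Ω, ℂ) x x ω = 0 :=
  Submodule.Quotient.mk_eq_zero _

lemma value_module_smul (a : C₀(Ω, ℂ)) (x : E) (ω : Ω) : value (a • x) ω = a ω • value x ω := by
  rw [← value_smul, ← sub_eq_zero, ← value_sub, value_eq_zero_iff]
  simp only [CStarModule.inner_sub_right, CStarModule.inner_sub_left,
    CStarModule.inner_smul_right_complex, CStarModule.inner_smul_left_complex,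
    CStarModule.inner_op_smul_right, CStarModule.inner_op_smul_left,
    ZeroAtInftyContinuousMap.sub_apply, ZeroAtInftyContinuousMap.mul_apply,
    ZeroAtInftyContinuousMap.smul_apply, ZeroAtInftyContinuousMap.star_apply, smul_eq_mul]
  ring

lemma norm_inner_module_smul_self (a : C₀(Ω, ℂ)) (x : E) (ω : Ω) :
    ‖inner C₀(Ω, ℂ) (a • x) (a • x) ω‖ = ‖a ω‖ ^ 2 * ‖inner C₀(Ω, ℂ) x x ω‖ := by
  simp only [CStarModule.inner_op_smul_right, CStarModule.inner_op_smul_left,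
    ZeroAtInftyContinuousMap.mul_apply, ZeroAtInftyContinuousMap.star_apply, norm_mul, norm_star]
  ring

lemma exists_value_eq_and_norm_sq_le (x : E) (ω : Ω) :
    ∃ y : E, value y ω = value x ω ∧ ‖y‖ ^ 2 ≤ ‖inner C₀(Ω, ℂ) x x ω‖ := by
  rcases (norm_nonneg (inner C₀(Ω, ℂ) x x ω)).eq_or_lt with hr | hr
  · exact ⟨0, by rw [value_zero, value_eq_zero_iff.2 (norm_eq_zero.1 hr.symm)], by simp⟩
  set r := ‖inner C₀(Ω, ℂ) x x ω‖
  -- `y = k(⟨x, x⟩) x` with `k(t) = 2 r² t / (r³ + t³)`, so that `k(r) = 1` and `k(t)² t ≤ r`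
  have hpos : ∀ z : ℂ, 0 < r ^ 3 + ‖z‖ ^ 3 := fun z => by positivity
  let k : C(ℂ, ℂ) := ⟨fun z => ((2 * r ^ 2 * ‖z‖ / (r ^ 3 + ‖z‖ ^ 3) : ℝ) : ℂ),
    Complex.continuous_ofReal.comp (by fun_prop (disch := exact fun z => (hpos z).ne'))⟩
  refine ⟨postcomp k (by simp [k]) (inner C₀(Ω, ℂ) x x) • x, ?_, ?_⟩
  · rw [value_module_smul]
    have : 2 * r ^ 2 * r / (r ^ 3 + r ^ 3) = 1 := by field_simp; norm_num
    change ((2 * r ^ 2 * r / (r ^ 3 + r ^ 3) : ℝ) : ℂ) • value x ω = value x ω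
    rw [this, Complex.ofReal_one, one_smul]
  · refine (norm_sq_le_iff (Ω := Ω) hr.le).2 fun η => ?_
    rw [norm_inner_module_smul_self]
    have h := hpos (inner C₀(Ω, ℂ) x x η)
    set t := ‖inner C₀(Ω, ℂ) x x η‖
    change ‖((2 * r ^ 2 * t / (r ^ 3 + t ^ 3) : ℝ) : ℂ)‖ ^ 2 * t ≤ r
    rw [Complex.norm_real, Real.norm_eq_abs, sq_abs, div_pow, div_mul_eq_mul_div,
      div_le_iff₀ (pow_pos h 2)]
    nlinarith [mul_nonneg hr.le (sq_nonneg (r ^ 3 - t ^ 3))]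

lemma norm_value_sq (x : E) (ω : Ω) : ‖value x ω‖ ^ 2 = ‖inner C₀(Ω, ℂ) x x ω‖ := by
  apply le_antisymm
  · obtain ⟨y, hy, hyn⟩ := exists_value_eq_and_norm_sq_le x ω
    rw [← hy]
    exact (pow_le_pow_left₀ (norm_nonneg _) (Submodule.Quotient.norm_mk_le _ y) 2).trans hyn
  · rw [← Real.sqrt_le_left (norm_nonneg _)]
    refine QuotientAddGroup.le_norm_iff.2 fun y (hy : value y ω = value x ω) => ?_
    rw [Real.sqrt_le_left (norm_nonneg _), ← inner_value, ← hy, inner_value]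
    exact (norm_sq_le_iff (sq_nonneg _)).1 le_rfl ω

/-- The norm is the quotient norm that Mathlib puts on `E ⧸ vanishingAt E ω`. -/
noncomputable instance (ω : Ω) : InnerProductSpace ℂ (Fibre E ω) where
  norm_sq_eq_re_inner u := by
    obtain ⟨x, rfl⟩ := value_surjective ω u
    rw [norm_value_sq, inner_value, inner_self_apply]
    simp
  conj_inner_symm u v := by
    obtain ⟨x, rfl⟩ := value_surjective ω u
    obtain ⟨y, rfl⟩ := value_surjective ω v
    exact star_inner_apply y x ω
  add_left u v w := by
    obtain ⟨x, rfl⟩ := value_surjective ω u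
    obtain ⟨y, rfl⟩ := value_surjective ω v
    obtain ⟨z, rfl⟩ := value_surjective ω w
    simp only [← value_add, inner_value, CStarModule.inner_add_left,
      ZeroAtInftyContinuousMap.add_apply]
  smul_left u v c := by
    obtain ⟨x, rfl⟩ := value_surjective ω u
    obtain ⟨y, rfl⟩ := value_surjective ω v
    simp only [← value_smul, inner_value, CStarModule.inner_smul_left_complex]
    rfl

instance (ω : Ω) : IsClosed (vanishingAt E ω : Set E) := by
  refine isClosed_of_closure_subset fun x hx => norm_eq_zero.1 ?_
  have hx : ‖value x ω‖ = 0 := QuotientAddGroup.norm_mk_eq_zero_iff_mem_closure.2 hx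
  rw [← norm_value_sq, hx, zero_pow two_ne_zero]

lemma norm_value_le (x : E) (ω : Ω) : ‖value x ω‖ ≤ ‖x‖ :=
  Submodule.Quotient.norm_mk_le _ x

lemma continuous_value (ω : Ω) : Continuous fun x : E => value x ω :=
  AddMonoidHomClass.continuous_of_bound (vanishingAt E ω).mkQ 1 fun x => by
    rw [one_mul]; exact norm_value_le x ω

lemma norm_le_of_norm_value_le {x : E} {C : ℝ} (hC : 0 ≤ C) (h : ∀ ω : Ω, ‖value x ω‖ ≤ C) :
    ‖x‖ ≤ C := by
  refine (sq_le_sq₀ (norm_nonneg _) hC).1 ((norm_sq_le_iff (Ω := Ω) (sq_nonneg C)).2 fun ω => ?_)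
  rw [← norm_value_sq]
  exact pow_le_pow_left₀ (norm_nonneg _) (h ω) 2

variable (Ω) in
lemma ext_value {x y : E} (h : ∀ ω : Ω, value x ω = value y ω) : x = y := by
  rw [← sub_eq_zero, ← norm_le_zero_iff]
  exact norm_le_of_norm_value_le le_rfl fun ω : Ω => by rw [value_sub, h, sub_self, norm_zero]

lemma exists_value_eq_and_norm_eq {ω : Ω} (u : Fibre E ω) :
    ∃ x : E, value x ω = u ∧ ‖x‖ = ‖u‖ := by
  obtain ⟨x, rfl⟩ := value_surjective ω u
  obtain ⟨y, hy, hyn⟩ := exists_value_eq_and_norm_sq_le x ω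
  rw [← norm_value_sq, sq_le_sq₀ (norm_nonneg _) (norm_nonneg _)] at hyn
  exact ⟨y, hy, hyn.antisymm (hy ▸ norm_value_le y ω)⟩

/-- The fibrewise norm `ω ↦ ‖x(ω)‖` of a section. -/
noncomputable def fibreNorm (x : E) : C₀(Ω, ℝ) :=
  postcomp ⟨fun z : ℂ => √‖z‖, by fun_prop⟩ (by simp) (inner C₀(Ω, ℂ) x x)

lemma fibreNorm_apply (x : E) (ω : Ω) : fibreNorm x ω = ‖value x ω‖ := by
  rw [← Real.sqrt_sq (norm_nonneg (value x ω)), norm_value_sq]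
  rfl

lemma continuous_norm_value (x : E) : Continuous fun ω : Ω => ‖value x ω‖ := by
  simpa only [← fibreNorm_apply] using map_continuous (fibreNorm x)

end Fibre

section Multiplier

lemma exists_zeroAtInfty_eq_of_le {Ω : Type*} [TopologicalSpace Ω] (N : C₀(Ω, ℝ)) {g : Ω → ℂ}
    (hg : ContinuousOn g {ω | 0 < N ω}) {δ : ℝ} (hδ : 0 < δ) :
    ∃ a : C₀(Ω, ℂ), (∀ ω, ‖g ω - a ω‖ ≤ ‖g ω‖) ∧ ∀ ω, δ ≤ N ω → a ω = g ω := by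
  let χ : Ω → ℝ := fun ω => max 0 (min 1 (2 * N ω / δ - 1))
  have hχ : Continuous χ := by have := map_continuous N; fun_prop
  have hχ_zero : ∀ ω, N ω < δ / 2 → (χ ω : ℂ) * g ω = 0 := fun ω hω => by
    have : 2 * N ω / δ - 1 ≤ 0 := by rw [sub_nonpos, div_le_one hδ]; linarith
    simp [χ, max_eq_left ((min_le_right _ _).trans this)]
  have hχ_one : ∀ ω, δ ≤ N ω → χ ω = 1 := fun ω hω => by
    have : 1 ≤ 2 * N ω / δ - 1 := by rw [le_sub_iff_add_le, le_div_iff₀ hδ]; linarith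
    simp only [χ, min_eq_left this, max_eq_right zero_le_one]
  have hcont : Continuous fun ω => (χ ω : ℂ) * g ω := by
    refine continuous_iff_continuousAt.2 fun ω => ?_
    by_cases hω : N ω < δ / 2
    · refine (continuousAt_const (y := (0 : ℂ))).congr ?_
      filter_upwards [(map_continuous N).continuousAt.eventually_lt_const hω] with η hη
      exact (hχ_zero η hη).symm
    · exact (Complex.continuous_ofReal.comp hχ).continuousAt.mul (hg.continuousAt
        ((isOpen_lt continuous_const (map_continuous N)).mem_nhds
          ((half_pos hδ).trans_le (not_lt.1 hω))))
  have hinfty : Tendsto (fun ω => (χ ω : ℂ) * g ω) (cocompact Ω) (𝓝 0) := by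
    refine tendsto_const_nhds.congr' ?_
    filter_upwards [N.zero_at_infty'.eventually_lt_const (half_pos hδ)] with ω hω
    exact (hχ_zero ω hω).symm
  refine ⟨⟨⟨_, hcont⟩, hinfty⟩, fun ω => ?_, fun ω hω => ?_⟩
  · change ‖g ω - χ ω * g ω‖ ≤ ‖g ω‖
    have hχ_nonneg : 0 ≤ χ ω := le_max_left _ _
    have hχ_le_one : χ ω ≤ 1 := max_le zero_le_one (min_le_left _ _)
    rw [← one_sub_mul, norm_mul, ← Complex.ofReal_one, ← Complex.ofReal_sub, Complex.norm_real,
      Real.norm_of_nonneg (sub_nonneg.2 hχ_le_one)]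
    exact mul_le_of_le_one_left (norm_nonneg _) (sub_le_self _ hχ_nonneg)
  · change (χ ω : ℂ) * g ω = g ω
    rw [hχ_one ω hω, Complex.ofReal_one, one_mul]

variable {Ω E : Type*} [TopologicalSpace Ω] [NormedAddCommGroup E] [NormedSpace ℂ E]
  [CompleteSpace E] [SMul C₀(Ω, ℂ) E] [CStarModule C₀(Ω, ℂ) E]

lemma exists_value_eq_of_approx (s : ∀ ω : Ω, Fibre E ω)
    (hs : ∀ ε > 0, ∃ x : E, ∀ ω, ‖value x ω - s ω‖ ≤ ε) : ∃ x : E, ∀ ω, value x ω = s ω := by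
  choose x hx using fun n : ℕ => hs (1 / (n + 1)) Nat.one_div_pos_of_nat
  have htwo : Tendsto (fun n : ℕ => 1 / ((n : ℝ) + 1) + 1 / ((n : ℝ) + 1)) atTop (𝓝 0) := by
    simpa using (tendsto_one_div_add_atTop_nhds_zero_nat (𝕜 := ℝ)).add
      tendsto_one_div_add_atTop_nhds_zero_nat
  have hcauchy : CauchySeq x := by
    refine cauchySeq_of_le_tendsto_0' _ (fun n m hnm => ?_) htwo
    rw [dist_eq_norm]
    refine norm_le_of_norm_value_le (by positivity) fun ω : Ω => ?_
    rw [value_sub, ← sub_sub_sub_cancel_right _ _ (s ω)]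
    exact (norm_sub_le _ _).trans
      (add_le_add (hx n ω) ((hx m ω).trans (Nat.one_div_le_one_div hnm)))
  obtain ⟨y, hy⟩ := cauchySeq_tendsto_of_complete hcauchy
  refine ⟨y, fun ω => tendsto_nhds_unique (((continuous_value ω).tendsto y).comp hy) ?_⟩
  exact tendsto_iff_norm_sub_tendsto_zero.2
    (squeeze_zero (fun _ => norm_nonneg _) (hx · ω) tendsto_one_div_add_atTop_nhds_zero_nat)

lemma exists_value_eq_smul (e : E) {g : Ω → ℂ} (hg : ContinuousOn g {ω | 0 < ‖value e ω‖})
    (hsmall : Tendsto (fun ω => ‖g ω‖ * ‖value e ω‖) (comap (fun ω => ‖value e ω‖) (𝓝 0)) (𝓝 0)) :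
    ∃ x : E, ∀ ω, value x ω = g ω • value e ω := by
  refine exists_value_eq_of_approx _ fun ε hε => ?_
  obtain ⟨δ, hδ, hball⟩ := Metric.eventually_nhds_iff.1
    (eventually_comap.1 (hsmall.eventually_le_const hε))
  obtain ⟨a, ha, hag⟩ := exists_zeroAtInfty_eq_of_le (fibreNorm e) (g := g)
    (by simpa only [fibreNorm_apply] using hg) hδ
  refine ⟨a • e, fun ω => ?_⟩
  rw [value_module_smul, ← sub_smul, norm_smul, norm_sub_rev]
  rcases lt_or_ge ‖value e ω‖ δ with hω | hω
  · exact (mul_le_mul_of_nonneg_right (ha ω) (norm_nonneg _)).trans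
      (hball (by rwa [dist_zero_right, norm_norm]) ω rfl)
  · rw [hag ω ((fibreNorm_apply e ω).symm ▸ hω), sub_self, norm_zero, zero_mul]
    exact hε.le

lemma exists_value_eq_boundedContinuous_smul (g : Ω →ᵇ ℂ) (e : E) :
    ∃ x : E, ∀ ω, value x ω = g ω • value e ω := by
  refine exists_value_eq_smul e g.continuous.continuousOn ?_
  refine squeeze_zero (fun ω => by positivity)
    (fun ω => mul_le_mul_of_nonneg_right (g.norm_coe_le_norm ω) (norm_nonneg _)) ?_
  simpa using (tendsto_comap (f := fun ω => ‖value e ω‖) (x := 𝓝 0)).const_mul ‖g‖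

/-- Multiplication of sections by a bounded continuous function, that is, the action on `E` of the
multiplier algebra of `C₀(Ω)`. -/
noncomputable def multiplier (g : Ω →ᵇ ℂ) : E →ₗ[ℂ] E where
  toFun e := (exists_value_eq_boundedContinuous_smul g e).choose
  map_add' x y := ext_value Ω fun ω => by
    rw [value_add, (exists_value_eq_boundedContinuous_smul g (x + y)).choose_spec,
      (exists_value_eq_boundedContinuous_smul g x).choose_spec,
      (exists_value_eq_boundedContinuous_smul g y).choose_spec, value_add, smul_add]
  map_smul' c x := ext_value Ω fun ω => by
    rw [RingHom.id_apply, value_smul,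
      (exists_value_eq_boundedContinuous_smul g (c • x)).choose_spec,
      (exists_value_eq_boundedContinuous_smul g x).choose_spec, value_smul, smul_comm]

lemma value_multiplier (g : Ω →ᵇ ℂ) (e : E) (ω : Ω) :
    value (multiplier g e) ω = g ω • value e ω :=
  (exists_value_eq_boundedContinuous_smul g e).choose_spec ω

end Multiplier

section Staircase

/-- A continuous function `s ≤ id` that is constant on each interval `[n, n + 2/3]` with `n` an
integer. -/
noncomputable def staircase (u : ℝ) : ℝ :=
  u + (max 0 (3 * Int.fract u - 2) - Int.fract u)

lemma continuous_staircase : Continuous staircase := by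
  have h : Continuous ((fun v : ℝ => max 0 (3 * v - 2) - v) ∘ Int.fract) :=
    ContinuousOn.comp_fract'' (by fun_prop) (by norm_num)
  exact continuous_id.add h

lemma staircase_le (u : ℝ) : staircase u ≤ u := by
  have hmax : max 0 (3 * Int.fract u - 2) ≤ Int.fract u :=
    max_le (Int.fract_nonneg u) (by linarith [Int.fract_lt_one u])
  unfold staircase
  linarith

lemma floor_le_staircase (u : ℝ) : ⌊u⌋ ≤ staircase u := by
  unfold staircase
  linarith [Int.self_sub_fract u, le_max_left 0 (3 * Int.fract u - 2)]

lemma staircase_eq_of_mem_Ioo {n : ℤ} {u : ℝ} (hu : u ∈ Set.Ioo (n : ℝ) (n + 2 / 3)) :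
    staircase u = n := by
  have hfloor : ⌊u⌋ = n := Int.floor_eq_iff.2 ⟨hu.1.le, by linarith [hu.2]⟩
  have hfract : Int.fract u = u - n := by rw [← Int.self_sub_floor, hfloor]
  rw [staircase, hfract, max_eq_left (by linarith [hu.2])]
  ring

lemma exists_mem_Ioo_or_add_half_mem_Ioo (u : ℝ) :
    ∃ n : ℤ, u ∈ Set.Ioo (n : ℝ) (n + 2 / 3) ∨ u + 1 / 2 ∈ Set.Ioo (n : ℝ) (n + 2 / 3) := by
  have hfloor := Int.floor_add_fract u
  have hlt := Int.fract_lt_one u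
  rcases (Int.fract_nonneg u).eq_or_lt with hzero | hpos
  · exact ⟨⌊u⌋, Or.inr ⟨by linarith, by linarith⟩⟩
  · rcases lt_or_ge (Int.fract u) (2 / 3) with h | h
    · exact ⟨⌊u⌋, Or.inl ⟨by linarith, by linarith⟩⟩
    · exact ⟨⌊u⌋ + 1, Or.inr ⟨by push_cast; linarith, by push_cast; linarith⟩⟩

lemma exists_value_eq_staircase_smul {Ω E : Type*} [TopologicalSpace Ω] [NormedAddCommGroup E]
    [NormedSpace ℂ E] [CompleteSpace E] [SMul C₀(Ω, ℂ) E] [CStarModule C₀(Ω, ℂ) E] (e : E)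
    {c : ℝ} (hc : 0 ≤ c) :
    ∃ x : E, ∀ ω : Ω, value x ω = (staircase ((√‖value e ω‖)⁻¹ + c) : ℂ) • value e ω := by
  refine exists_value_eq_smul e (fun ω hω => ?_) ?_
  · have hsqrt : √‖value e ω‖ ≠ 0 := (Real.sqrt_pos.2 hω).ne'
    have hcont : ContinuousAt (fun η => (√‖value e η‖)⁻¹ + c) ω :=
      ((continuous_norm_value e).continuousAt.sqrt.inv₀ hsqrt).add_const c
    exact (Complex.continuous_ofReal.continuousAt.comp
      (continuous_staircase.continuousAt.comp hcont)).continuousWithinAt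
  · have hbound : Tendsto (fun r : ℝ => √r + c * r) (𝓝 0) (𝓝 0) := by
      have hcont : Continuous fun r : ℝ => √r + c * r := by fun_prop
      simpa using hcont.tendsto 0
    refine squeeze_zero (fun ω => by positivity) (fun ω => ?_) (hbound.comp tendsto_comap)
    have hu : 0 ≤ (√‖value e ω‖)⁻¹ + c := by positivity
    have hfloor : (0 : ℝ) ≤ ⌊(√‖value e ω‖)⁻¹ + c⌋ := by exact_mod_cast Int.floor_nonneg.2 hu
    rw [Complex.norm_real, Real.norm_of_nonneg (hfloor.trans (floor_le_staircase _))]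
    calc _ ≤ ((√‖value e ω‖)⁻¹ + c) * ‖value e ω‖ :=
          mul_le_mul_of_nonneg_right (staircase_le _) (norm_nonneg _)
      _ = √‖value e ω‖ + c * ‖value e ω‖ := by
          rw [add_mul, inv_mul_eq_div, Real.div_sqrt]

end Staircase

section Local

variable {Ω E F : Type*} [TopologicalSpace Ω]
  [NormedAddCommGroup E] [NormedSpace ℂ E] [SMul C₀(Ω, ℂ) E]
  [NormedAddCommGroup F] [NormedSpace ℂ F] [SMul C₀(Ω, ℂ) F] [CStarModule C₀(Ω, ℂ) F]
  {θ : E →ₗ[ℂ] F}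

lemma IsLocal.value_map_eq_zero_of_smul_eq_zero (hloc : IsLocal Ω θ) {a : C₀(Ω, ℂ)} {x : E}
    (hax : a • x = 0) {ω : Ω} (ha : a ω ≠ 0) : value (θ x) ω = 0 := by
  have h : a ω • value (θ x) ω = 0 := by rw [← value_module_smul, hloc x a hax, value_zero]
  exact (smul_eq_zero.1 h).resolve_left ha

variable [CStarModule C₀(Ω, ℂ) E]

lemma IsLocal.value_map_eq_smul_of_eventually (hloc : IsLocal Ω θ) {x e : E} {k : ℂ} {ω : Ω}
    (he : value e ω ≠ 0)
    (h : ∀ᶠ r in 𝓝 ‖value e ω‖, ∀ η : Ω, ‖value e η‖ = r → value x η = k • value e η) :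
    value (θ x) ω = k • value (θ e) ω := by
  rw [← sub_eq_zero, ← value_smul, ← map_smul, ← value_sub, ← map_sub]
  obtain ⟨δ, hδ, hball⟩ := Metric.eventually_nhds_iff.1 h
  -- a bump in the norm of `e`, localised near `ω` and vanishing where `e` does
  let bump : C(ℝ, ℂ) := ⟨fun r => ((max 0 (min δ ‖value e ω‖ - |r - ‖value e ω‖|) : ℝ) : ℂ),
    Complex.continuous_ofReal.comp (by fun_prop)⟩
  have hbump_zero : bump 0 = 0 := by simp [bump]
  refine hloc.value_map_eq_zero_of_smul_eq_zero (a := postcomp bump hbump_zero (fibreNorm e))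
    (ext_value Ω fun η => ?_) ?_
  · rw [value_module_smul, value_zero, smul_eq_zero, or_iff_not_imp_left]
    intro hη
    change bump (fibreNorm e η) ≠ 0 at hη
    rw [fibreNorm_apply] at hη
    have hdist : |‖value e η‖ - ‖value e ω‖| < min δ ‖value e ω‖ := by
      by_contra! hle
      exact hη (by simp [bump, hle])
    rw [value_sub, value_smul, hball (hdist.trans_le (min_le_left _ _)) η rfl, sub_self]
  · change bump (fibreNorm e ω) ≠ 0
    rw [fibreNorm_apply]
    simpa [bump] using (lt_min hδ (norm_pos_iff.2 he)).not_ge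

variable [CompleteSpace E]

lemma IsLocal.exists_norm_value_map_le_mul_sqrt_of_mem_Ioo (hloc : IsLocal Ω θ) (e : E) {c : ℝ}
    (hc : 0 ≤ c) : ∃ M : ℝ, 0 ≤ M ∧ ∀ (ω : Ω) (n : ℤ), value e ω ≠ 0 →
      (√‖value e ω‖)⁻¹ + c ∈ Set.Ioo (n : ℝ) (n + 2 / 3) →
        ‖value (θ e) ω‖ ≤ M * √‖value e ω‖ := by
  obtain ⟨x, hx⟩ := exists_value_eq_staircase_smul (Ω := Ω) e hc
  refine ⟨‖θ x‖ + ‖θ e‖, by positivity, fun ω n he hn => ?_⟩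
  have hpos : 0 < √‖value e ω‖ := Real.sqrt_pos.2 (norm_pos_iff.2 he)
  have hmap : value (θ x) ω = ((n : ℝ) : ℂ) • value (θ e) ω := by
    refine hloc.value_map_eq_smul_of_eventually he ?_
    have hcont : ContinuousAt (fun r : ℝ => (√r)⁻¹ + c) ‖value e ω‖ :=
      (Real.continuous_sqrt.continuousAt.inv₀ hpos.ne').add_const c
    filter_upwards [hcont (isOpen_Ioo.mem_nhds hn)] with r hr η hη
    rw [hx, hη, staircase_eq_of_mem_Ioo hr]
  have hn_le : n * ‖value (θ e) ω‖ ≤ ‖θ x‖ := by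
    refine le_trans ?_ (norm_value_le (θ x) ω)
    rw [hmap, norm_smul, Complex.norm_real]
    exact mul_le_mul_of_nonneg_right (le_abs_self _) (norm_nonneg _)
  rw [← div_le_iff₀ hpos, div_eq_inv_mul]
  calc (√‖value e ω‖)⁻¹ * ‖value (θ e) ω‖
    _ ≤ (n + 1) * ‖value (θ e) ω‖ := by gcongr; linarith [hn.2]
    _ ≤ ‖θ x‖ + ‖θ e‖ := by linarith [norm_value_le (θ e) ω]

lemma IsLocal.exists_norm_value_map_le_mul_sqrt (hloc : IsLocal Ω θ) (e : E) :
    ∃ M : ℝ, ∀ ω : Ω, value e ω ≠ 0 → ‖value (θ e) ω‖ ≤ M * √‖value e ω‖ := by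
  obtain ⟨M₀, hM₀, h₀⟩ := hloc.exists_norm_value_map_le_mul_sqrt_of_mem_Ioo e le_rfl
  obtain ⟨M₁, hM₁, h₁⟩ := hloc.exists_norm_value_map_le_mul_sqrt_of_mem_Ioo e one_half_pos.le
  refine ⟨M₀ + M₁, fun ω he => ?_⟩
  obtain ⟨n, hn | hn⟩ := exists_mem_Ioo_or_add_half_mem_Ioo (√‖value e ω‖)⁻¹
  · exact (h₀ ω n he (by rwa [add_zero])).trans (by gcongr; linarith)
  · exact (h₁ ω n he hn).trans (by gcongr; linarith)

lemma IsLocal.value_map_eq_zero (hloc : IsLocal Ω θ) {e : E} {ω : Ω} (he : value e ω = 0) :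
    value (θ e) ω = 0 := by
  obtain ⟨M, hM⟩ := hloc.exists_norm_value_map_le_mul_sqrt e
  -- the positive part of `‖θ e‖ - M √‖e‖` is supported in the zero set of `e`
  let a : C₀(Ω, ℂ) := postcomp ⟨fun r : ℝ => ((max 0 r : ℝ) : ℂ), by fun_prop⟩ (by simp)
    (fibreNorm (θ e) - M • postcomp ⟨Real.sqrt, Real.continuous_sqrt⟩ Real.sqrt_zero (fibreNorm e))
  have ha : ∀ η, a η = ((max 0 (‖value (θ e) η‖ - M * √‖value e η‖) : ℝ) : ℂ) := fun η => by
    rw [← fibreNorm_apply, ← fibreNorm_apply]; rfl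
  have hae : a • e = 0 := ext_value Ω fun η => by
    rw [value_module_smul, value_zero, smul_eq_zero, or_iff_not_imp_right]
    intro hη
    rw [ha, max_eq_left (sub_nonpos.2 (hM η hη)), Complex.ofReal_zero]
  by_contra hne
  refine hne (hloc.value_map_eq_zero_of_smul_eq_zero hae ?_)
  simpa [ha, he] using hne

/-- The linear map between the fibres at `ω` induced by a local map. -/
def IsLocal.fibreMap (hloc : IsLocal Ω θ) (ω : Ω) : Fibre E ω →ₗ[ℂ] Fibre F ω :=
  (vanishingAt E ω).mapQ (vanishingAt F ω) θ fun _ he =>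
    value_eq_zero_iff.1 (hloc.value_map_eq_zero (value_eq_zero_iff.2 he))

lemma IsLocal.fibreMap_value (hloc : IsLocal Ω θ) (ω : Ω) (x : E) :
    hloc.fibreMap ω (value x ω) = value (θ x) ω :=
  rfl

lemma IsLocal.map_module_smul (hloc : IsLocal Ω θ) (a : C₀(Ω, ℂ)) (x : E) :
    θ (a • x) = a • θ x := by
  refine ext_value Ω fun ω => ?_
  rw [value_module_smul, ← hloc.fibreMap_value, value_module_smul, map_smul, hloc.fibreMap_value]

end Local

section OrthogonalityPreserving

variable {𝕜 V W : Type*} [RCLike 𝕜] [SeminormedAddCommGroup V] [InnerProductSpace 𝕜 V]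
  [SeminormedAddCommGroup W] [InnerProductSpace 𝕜 W] {T : V →ₗ[𝕜] W}

lemma norm_sq_mul_inner_map_map (hT : ∀ u v, inner 𝕜 u v = 0 → inner 𝕜 (T u) (T v) = 0) (u v : V) :
    (‖u‖ : 𝕜) ^ 2 * inner 𝕜 (T u) (T v) = inner 𝕜 u v * (‖T u‖ : 𝕜) ^ 2 := by
  have horth : inner 𝕜 u ((‖u‖ : 𝕜) ^ 2 • v - inner 𝕜 u v • u) = 0 := by
    rw [inner_sub_right, inner_smul_right, inner_smul_right, inner_self_eq_norm_sq_to_K, mul_comm,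
      sub_self]
  have hmap := hT _ _ horth
  rwa [map_sub, map_smul, map_smul, inner_sub_right, inner_smul_right, inner_smul_right,
    inner_self_eq_norm_sq_to_K, sub_eq_zero] at hmap

lemma norm_map_mul_norm_of_inner_ne_zero
    (hT : ∀ u v, inner 𝕜 u v = 0 → inner 𝕜 (T u) (T v) = 0) {u v : V} (huv : inner 𝕜 u v ≠ 0) :
    ‖T u‖ * ‖v‖ = ‖T v‖ * ‖u‖ := by
  have hu := norm_sq_mul_inner_map_map hT u v
  have hv := congrArg (starRingEnd 𝕜) (norm_sq_mul_inner_map_map hT v u)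
  simp only [map_mul, map_pow, inner_conj_symm, RCLike.conj_ofReal] at hv
  have hsq : ((‖T u‖ * ‖v‖ : ℝ) : 𝕜) ^ 2 = ((‖T v‖ * ‖u‖ : ℝ) : 𝕜) ^ 2 := by
    apply mul_left_cancel₀ huv
    push_cast
    linear_combination (‖u‖ : 𝕜) ^ 2 * hv - (‖v‖ : 𝕜) ^ 2 * hu
  exact (pow_left_inj₀ (by positivity) (by positivity) two_ne_zero).1 (by exact_mod_cast hsq)

lemma norm_map_mul_norm (hT : ∀ u v, inner 𝕜 u v = 0 → inner 𝕜 (T u) (T v) = 0) (u v : V) :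
    ‖T u‖ * ‖v‖ = ‖T v‖ * ‖u‖ := by
  have hzero : ∀ w : V, ‖w‖ = 0 → ‖T w‖ = 0 := fun w hw => by
    have h := hT w w (by simp [inner_self_eq_norm_sq_to_K, hw])
    simpa [inner_self_eq_norm_sq_to_K] using h
  by_cases huv : inner 𝕜 u v = 0
  · by_cases hu : ‖u‖ = 0
    · rw [hu, hzero u hu, zero_mul, mul_zero]
    by_cases hv : ‖v‖ = 0
    · rw [hv, hzero v hv, zero_mul, mul_zero]
    -- `u + v` is orthogonal to neither `u` nor `v`
    have hu' : inner 𝕜 u (u + v) ≠ 0 := by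
      simpa [inner_add_right, huv, inner_self_eq_norm_sq_to_K] using hu
    have hv' : inner 𝕜 (u + v) v ≠ 0 := by
      simpa [inner_add_left, huv, inner_self_eq_norm_sq_to_K] using hv
    have hadd : ‖u + v‖ ≠ 0 := fun h => hu' (norm_le_zero_iff.1
      ((norm_inner_le_norm (𝕜 := 𝕜) _ _).trans_eq (by rw [h, mul_zero])))
    apply mul_right_cancel₀ hadd
    linear_combination ‖v‖ * norm_map_mul_norm_of_inner_ne_zero hT hu' +
      ‖u‖ * norm_map_mul_norm_of_inner_ne_zero hT hv'
  · exact norm_map_mul_norm_of_inner_ne_zero hT huv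

lemma exists_norm_map_eq_mul_norm (hT : ∀ u v, inner 𝕜 u v = 0 → inner 𝕜 (T u) (T v) = 0) :
    ∃ c : ℝ, 0 ≤ c ∧ ∀ u, ‖T u‖ = c * ‖u‖ := by
  by_cases hV : ∃ v : V, ‖v‖ ≠ 0
  · obtain ⟨v, hv⟩ := hV
    refine ⟨‖T v‖ / ‖v‖, by positivity, fun u => ?_⟩
    rw [div_mul_eq_mul_div, eq_div_iff hv, norm_map_mul_norm hT]
  · push Not at hV
    refine ⟨0, le_rfl, fun u => ?_⟩
    have h := hT u u (by simp [inner_self_eq_norm_sq_to_K, hV])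
    simpa [inner_self_eq_norm_sq_to_K] using h

end OrthogonalityPreserving

section Conformal

variable {Ω E F : Type*} [TopologicalSpace Ω]
  [NormedAddCommGroup E] [NormedSpace ℂ E] [SMul C₀(Ω, ℂ) E] [CStarModule C₀(Ω, ℂ) E]
  [NormedAddCommGroup F] [NormedSpace ℂ F] [SMul C₀(Ω, ℂ) F] [CStarModule C₀(Ω, ℂ) F]
  {θ : E →ₗ[ℂ] F} {ψ : Ω → ℝ}

/-- A linear map is conformal with factor `ψ` if it scales the norm of the fibre at each `ω` by
`ψ ω`. -/
def IsConformal (θ : E →ₗ[ℂ] F) (ψ : Ω → ℝ) : Prop :=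
  ∀ (x : E) (ω : Ω), ‖value (θ x) ω‖ = ψ ω * ‖value x ω‖

lemma PreservesOrthogonality.inner_fibreMap_eq_zero [CompleteSpace E]
    (horth : PreservesOrthogonality Ω θ) (hloc : IsLocal Ω θ) {ω : Ω} {u v : Fibre E ω}
    (huv : inner ℂ u v = 0) : inner ℂ (hloc.fibreMap ω u) (hloc.fibreMap ω v) = 0 := by
  obtain ⟨x, rfl⟩ := value_surjective ω u
  obtain ⟨y, rfl⟩ := value_surjective ω v
  by_cases hx : value x ω = 0
  · simp only [hx, map_zero, inner_zero_left]
  have hz : inner C₀(Ω, ℂ) x (inner C₀(Ω, ℂ) x x • y - inner C₀(Ω, ℂ) x y • x) = 0 := by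
    rw [CStarModule.inner_sub_right, CStarModule.inner_op_smul_right,
      CStarModule.inner_op_smul_right, mul_comm, sub_self]
  have hθz := DFunLike.congr_fun (horth _ _ hz) ω
  rw [← inner_value, ← hloc.fibreMap_value, ← hloc.fibreMap_value, value_sub, value_module_smul,
    value_module_smul, ← inner_value x y, huv, zero_smul, sub_zero, map_smul, inner_smul_right]
    at hθz
  exact (mul_eq_zero.1 hθz).resolve_left (mt value_eq_zero_iff.2 hx)

lemma PreservesOrthogonality.exists_isConformal [CompleteSpace E]
    (horth : PreservesOrthogonality Ω θ) (hloc : IsLocal Ω θ) :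
    ∃ ψ : Ω → ℝ, (∀ ω, 0 ≤ ψ ω) ∧ IsConformal θ ψ := by
  choose ψ hψ hscale using fun ω => exists_norm_map_eq_mul_norm
    (T := hloc.fibreMap ω) fun u v => horth.inner_fibreMap_eq_zero hloc
  exact ⟨ψ, hψ, fun x ω => hscale ω (value x ω)⟩

lemma IsConformal.map_module_smul (hθ : IsConformal θ ψ) (a : C₀(Ω, ℂ)) (x : E) :
    θ (a • x) = a • θ x := by
  refine ext_value Ω fun ω => ?_
  have hzero : value (a • x - a ω • x) ω = 0 := by
    rw [value_sub, value_smul, value_module_smul, sub_self]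
  have h : ‖value (θ (a • x - a ω • x)) ω‖ = 0 := by rw [hθ, hzero, norm_zero, mul_zero]
  rw [norm_eq_zero, map_sub, map_smul θ (a ω) x, value_sub, value_smul, sub_eq_zero] at h
  rw [h, value_module_smul]

lemma IsConformal.mem_boundedModuleHoms_of_le (hθ : IsConformal θ ψ) {C : ℝ} (hC : 0 ≤ C)
    (hψ : ∀ ω, ψ ω ≤ C) : θ ∈ boundedModuleHoms Ω E F := by
  refine ⟨⟨C, fun x => norm_le_of_norm_value_le (by positivity) fun ω : Ω => ?_⟩,
    hθ.map_module_smul⟩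
  rw [hθ]
  exact mul_le_mul (hψ ω) (norm_value_le x ω) (norm_nonneg _) hC

lemma IsConformal.continuous [CompleteSpace E] [CompleteSpace F] (hθ : IsConformal θ ψ) :
    Continuous θ := by
  have hfibre : ∀ ω, Continuous fun x => value (θ x) ω := fun ω =>
    AddMonoidHomClass.continuous_of_bound ((vanishingAt F ω).mkQ ∘ₗ θ) |ψ ω| fun x =>
      (hθ x ω).trans_le
        (mul_le_mul (le_abs_self _) (norm_value_le x ω) (norm_nonneg _) (abs_nonneg _))
  refine θ.continuous_of_seq_closed_graph fun u x y hu hθu => ext_value Ω fun ω => ?_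
  exact tendsto_nhds_unique (((continuous_value ω).tendsto y).comp hθu)
    (((hfibre ω).tendsto x).comp hu)

lemma IsConformal.exists_factor_le [CompleteSpace E] [CompleteSpace F] (hθ : IsConformal θ ψ)
    (hE : ∀ ω : Ω, ∃ x : E, value x ω ≠ 0) : ∃ C, 0 ≤ C ∧ ∀ ω, ψ ω ≤ C := by
  let T : E →L[ℂ] F := ⟨θ, hθ.continuous⟩
  refine ⟨‖T‖, norm_nonneg T, fun ω => ?_⟩
  obtain ⟨e, he⟩ := hE ω
  obtain ⟨x, hx, hnorm⟩ := exists_value_eq_and_norm_eq (value e ω)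
  refine le_of_mul_le_mul_right ?_ (norm_pos_iff.2 he)
  calc ψ ω * ‖value e ω‖ = ‖value (T x) ω‖ := by rw [← hx]; exact (hθ x ω).symm
    _ ≤ ‖T x‖ := norm_value_le _ _
    _ ≤ ‖T‖ * ‖value e ω‖ := hnorm ▸ T.le_opNorm x

lemma IsConformal.continuous_factor (hθ : IsConformal θ ψ)
    (hE : ∀ ω : Ω, ∃ x : E, value x ω ≠ 0) : Continuous ψ := by
  refine continuous_iff_continuousAt.2 fun ω => ?_
  obtain ⟨x, hx⟩ := hE ω
  have hne := norm_ne_zero_iff.2 hx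
  refine ((continuous_norm_value (θ x)).continuousAt.div
    (continuous_norm_value x).continuousAt hne).congr ?_
  filter_upwards [(continuous_norm_value x).continuousAt.eventually_ne hne] with η hη
  rw [Pi.div_apply, hθ, mul_div_cancel_right₀ _ hη]

lemma IsConformal.injective (hθ : IsConformal θ ψ) (hψ : ∀ ω, ψ ω ≠ 0) :
    Function.Injective θ := by
  refine (injective_iff_map_eq_zero θ).2 fun x hx => ext_value Ω fun ω => ?_
  have h := hθ x ω
  rw [hx, value_zero, norm_zero, zero_eq_mul, norm_eq_zero] at h
  rw [h.resolve_left (hψ ω), value_zero]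

lemma IsConformal.symm {W : E ≃ₗ[ℂ] F} (hW : IsConformal W.toLinearMap ψ) (hψ : ∀ ω, ψ ω ≠ 0) :
    IsConformal W.symm.toLinearMap ψ⁻¹ := fun y ω => by
  have h := hW (W.symm y) ω
  rw [LinearEquiv.coe_coe, W.apply_symm_apply] at h
  rw [h, Pi.inv_apply, inv_mul_cancel_left₀ (hψ ω), LinearEquiv.coe_coe]

lemma IsConformal.inner_map_map {U : E →ₗ[ℂ] F} (hU : IsConformal U (1 : Ω → ℝ)) (x y : E) :
    inner C₀(Ω, ℂ) (U x) (U y) = inner C₀(Ω, ℂ) x y := by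
  have hnorm : ∀ (z : E) (ω : Ω), ‖value (U z) ω‖ = ‖value z ω‖ := fun z ω => by
    rw [hU, Pi.one_apply, one_mul]
  ext ω
  rw [← inner_value, ← inner_value, inner_eq_sum_norm_sq_div_four,
    inner_eq_sum_norm_sq_div_four (value x ω)]
  simp only [← value_add, ← value_sub, ← value_smul, ← map_add, ← map_sub, ← map_smul, hnorm]

lemma IsConformal.isUnitary {U : E →ₗ[ℂ] F} (hU : IsConformal U (1 : Ω → ℝ))
    (hsurj : Function.Surjective U) : IsUnitary Ω U := by
  have hone : ∀ ω : Ω, (1 : Ω → ℝ) ω ≠ 0 := fun _ => one_ne_zero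
  let W := LinearEquiv.ofBijective U ⟨hU.injective hone, hsurj⟩
  have hV : IsConformal W.symm.toLinearMap (1 : Ω → ℝ) := by
    simpa only [inv_one] using IsConformal.symm (W := W) hU hone
  refine ⟨hU.mem_boundedModuleHoms_of_le zero_le_one fun _ => le_rfl, W.symm,
    hV.mem_boundedModuleHoms_of_le zero_le_one fun _ => le_rfl, fun x y => ?_,
    LinearMap.ext W.symm_apply_apply, LinearMap.ext W.apply_symm_apply⟩
  rw [← hU.inner_map_map x]
  exact congrArg _ (W.apply_symm_apply y).symm

lemma IsConformal.exists_isUnitary [CompleteSpace F] {ψ : Ω →ᵇ ℝ} (hθ : IsConformal θ ψ)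
    (hsurj : Function.Surjective θ) (hψ : ∀ ω, 0 < ψ ω) {C : ℝ} (hC : ∀ ω, (ψ ω)⁻¹ ≤ C) :
    ∃ U : E →ₗ[ℂ] F, IsUnitary Ω U ∧ ∀ e ω, value (θ e) ω = (ψ ω : ℂ) • value (U e) ω := by
  have hne : ∀ ω, (ψ ω : ℂ) ≠ 0 := fun ω => Complex.ofReal_ne_zero.2 (hψ ω).ne'
  let g : Ω →ᵇ ℂ := .ofNormedAddCommGroup (fun ω => (ψ ω : ℂ)) (by fun_prop) ‖ψ‖ fun ω => by
    rw [Complex.norm_real]; exact ψ.norm_coe_le_norm ω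
  let h : Ω →ᵇ ℂ := .ofNormedAddCommGroup (fun ω => (ψ ω : ℂ)⁻¹)
    (Continuous.inv₀ (by fun_prop) hne) C fun ω => by
      rw [norm_inv, Complex.norm_real, Real.norm_of_nonneg (hψ ω).le]; exact hC ω
  have hvalue : ∀ e ω, value (multiplier h (θ e)) ω = (ψ ω : ℂ)⁻¹ • value (θ e) ω := fun e ω =>
    value_multiplier h (θ e) ω
  refine ⟨multiplier h ∘ₗ θ, IsConformal.isUnitary (fun e ω => ?_) fun y => ?_, fun e ω => ?_⟩
  · rw [LinearMap.comp_apply, hvalue, norm_smul, hθ, norm_inv, Complex.norm_real,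
      Real.norm_of_nonneg (hψ ω).le, inv_mul_cancel_left₀ (hψ ω).ne', Pi.one_apply, one_mul]
  · obtain ⟨x, hx⟩ := hsurj (multiplier g y)
    refine ⟨x, ext_value Ω fun ω => ?_⟩
    rw [LinearMap.comp_apply, hvalue, hx, value_multiplier]
    exact inv_smul_smul₀ (hne ω) _
  · rw [LinearMap.comp_apply, hvalue, smul_inv_smul₀ (hne ω)]

end Conformal

lemma IsFull.exists_value_ne_zero {Ω F : Type*} [TopologicalSpace Ω] [LocallyCompactSpace Ω]
    [RegularSpace Ω] [NormedAddCommGroup F] [NormedSpace ℂ F] [SMul C₀(Ω, ℂ) F]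
    [CStarModule C₀(Ω, ℂ) F] (hF : IsFull Ω F) (ω : Ω) : ∃ f : F, value f ω ≠ 0 := by
  by_contra! hzero
  let eval : C₀(Ω, ℂ) →L[ℂ] ℂ := LinearMap.mkContinuous
    ⟨⟨fun a => a ω, fun _ _ => rfl⟩, fun _ _ => rfl⟩ 1 fun a => by
      rw [one_mul]; exact a.toBCF.norm_coe_le_norm ω
  have heval : eval = 0 := by
    refine ContinuousLinearMap.ext_on hF ?_
    rintro _ ⟨x, y, rfl⟩
    change inner C₀(Ω, ℂ) x y ω = 0
    rw [← inner_value, hzero, inner_zero_left]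
  obtain ⟨f, hfω, -, hf, -⟩ := exists_continuous_one_zero_of_isCompact
    (isCompact_singleton (x := ω)) isClosed_empty (Set.disjoint_empty _)
  have hone : eval (postcomp ⟨Complex.ofReal, Complex.continuous_ofReal⟩ Complex.ofReal_zero
      ⟨f, hf.is_zero_at_infty⟩) = 1 := by
    change (f ω : ℂ) = 1
    rw [hfω rfl, Pi.one_apply, Complex.ofReal_one]
  rw [heval] at hone
  exact zero_ne_one hone

end HilbertC0

open HilbertC0 in
theorem corollary3p9_general {Ω E F : Type*} [TopologicalSpace Ω]
    [NormedAddCommGroup E] [NormedSpace ℂ E] [CompleteSpace E]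
    [SMul C₀(Ω, ℂ) E] [CStarModule C₀(Ω, ℂ) E]
    [NormedAddCommGroup F] [NormedSpace ℂ F] [CompleteSpace F]
    [SMul C₀(Ω, ℂ) F] [CStarModule C₀(Ω, ℂ) F]
    (hF : ∀ ω : Ω, ∃ f : F, value f ω ≠ 0)
    (θ : E →ₗ[ℂ] F)
    (hsurj : Function.Surjective θ)
    (hloc : IsLocal Ω θ)
    (horth : PreservesOrthogonality Ω θ) :
    θ ∈ boundedModuleHoms Ω E F ∧
      ∃ (ψ : Ω →ᵇ ℝ) (U : E →ₗ[ℂ] F),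
        (∀ ω, 0 < ψ ω) ∧ IsUnitary Ω U ∧
          ∀ (e : E) (ω : Ω),
            value (θ e) ω = (ψ ω : ℂ) • value (U e) ω := by
  obtain ⟨ψ, hψ_nonneg, hθ⟩ := horth.exists_isConformal hloc
  have hne : ∀ ω, ψ ω ≠ 0 ∧ ∃ x : E, value x ω ≠ 0 := fun ω => by
    obtain ⟨f, hf⟩ := hF ω
    obtain ⟨x, rfl⟩ := hsurj f
    rw [← norm_ne_zero_iff, hθ, mul_ne_zero_iff, norm_ne_zero_iff] at hf
    exact ⟨hf.1, x, hf.2⟩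
  have hψ : ∀ ω, 0 < ψ ω := fun ω => (hψ_nonneg ω).lt_of_ne' (hne ω).1
  obtain ⟨C, hC, hψ_le⟩ := hθ.exists_factor_le fun ω => (hne ω).2
  let W := LinearEquiv.ofBijective θ ⟨hθ.injective fun ω => (hne ω).1, hsurj⟩
  obtain ⟨D, -, hψ_inv_le⟩ := (IsConformal.symm (W := W) hθ fun ω => (hne ω).1).exists_factor_le hF
  let Ψ : Ω →ᵇ ℝ := .ofNormedAddCommGroup ψ (hθ.continuous_factor fun ω => (hne ω).2) C fun ω => by
    rw [Real.norm_of_nonneg (hψ_nonneg ω)]; exact hψ_le ω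
  obtain ⟨U, hU, hθU⟩ := IsConformal.exists_isUnitary (ψ := Ψ) hθ hsurj hψ hψ_inv_le
  exact ⟨hθ.mem_boundedModuleHoms_of_le hC hψ_le, Ψ, U, hψ, hU, hθU⟩

theorem corollary3p9 {Ω E F : Type*} [TopologicalSpace Ω] [LocallyCompactSpace Ω] [T2Space Ω]
    [NormedAddCommGroup E] [NormedSpace ℂ E] [CompleteSpace E]
    [SMul C₀(Ω, ℂ) E] [CStarModule C₀(Ω, ℂ) E]
    [NormedAddCommGroup F] [NormedSpace ℂ F] [CompleteSpace F]
    [SMul C₀(Ω, ℂ) F] [CStarModule C₀(Ω, ℂ) F]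
    (hF : HilbertC0.IsFull Ω F)
    (θ : E →ₗ[ℂ] F)
    (hsurj : Function.Surjective θ)
    (hloc : HilbertC0.IsLocal Ω θ)
    (horth : HilbertC0.PreservesOrthogonality Ω θ) :
    θ ∈ HilbertC0.boundedModuleHoms Ω E F ∧
      ∃ (ψ : Ω →ᵇ ℝ) (U : E →ₗ[ℂ] F),
        (∀ ω, 0 < ψ ω) ∧ HilbertC0.IsUnitary Ω U ∧
          ∀ (e : E) (ω : Ω),
            HilbertC0.value (θ e) ω = (ψ ω : ℂ) • HilbertC0.value (U e) ω :=
  corollary3p9_general hF.exists_value_ne_zero θ hsurj hloc horth
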